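/- Let $Y$ be a locally Noetherian scheme (for instance a closed subscheme of $\mathbb{P}^N_k$, $k$ a field), let $X \subset Y$ be a closed subscheme with ideal sheaf $\mathcal{I}$, and let $\pi : \tilde{Y} \to Y$ be the blowup of $Y$ along $X$. The distinguished varieties of $X$ in $Y$ are the images in $Y$ of the irreducible components of the normal cone $C_XY = \operatorname{Spec}_Y\big(\bigoplus_{n\ge 0} \mathcal{I}^n/\mathcal{I}^{n+1}\big)$. Let $K \subset Y$ be an effective Cartier divisor that contains none of the distinguished varieties of $X$ in $Y$. Let $\tilde{K}$, the proper transform of $K$, be the blowup of $K$ along $X \cap K$, with its canonical morphism $j : \tilde{K} \to \tilde{Y}$ over $Y$, and let $\pi^{-1}(K)$, the total transform, be the scheme-theoretic inverse image of $K$. Then $j$ is a closed immersion, and $\tilde{K}$ and $\pi^{-1}(K)$ are equal as closed subsets of $\tilde{Y}$ and as cycles on $\tilde{Y}$ (that is, $[\tilde{K}] = [\pi^{-1}(K)]$: they have the same irreducible components with the same multiplicities, where the multiplicity of a component is the length of the local ring at its generic point). If moreover the scheme $\pi^{-1}(K)$ has no embedded points, then $\tilde{K} = \pi^{-1}(K)$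 as closed subschemes of $\tilde{Y}$. -/

import Mathlib

open CategoryTheory AlgebraicGeometry Polynomial

universe u

noncomputable section Algebra
variable {A B : Type u} [CommRing A] [CommRing B]

/-- The map of Rees algebras `⨁ Iⁿ → ⨁ Jⁿ` induced by a ring map sending `I` into `J`. -/
def reesMap (φ : A →+* B) {I : Ideal A} {J : Ideal B} (h : I.map φ ≤ J) :
    reesAlgebra I →+* reesAlgebra J :=
  (Polynomial.mapRingHom φ).restrict (reesAlgebra I) (reesAlgebra J) fun p hp i ↦ by
    rw [coe_mapRingHom, coeff_map]
    have := Ideal.mem_map_of_mem φ (hp i)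
    rw [Ideal.map_pow] at this
    exact Ideal.pow_right_mono h i this

/-- The associated graded ring `gr_I A = ⨁ Iⁿ / Iⁿ⁺¹`, as the quotient of the Rees algebra
`⨁ Iⁿ` by the ideal generated by `I` (placed in degree `0`). -/
def AssocGraded (I : Ideal A) : Type u :=
  reesAlgebra I ⧸ I.map (algebraMap A (reesAlgebra I))

instance (I : Ideal A) : CommRing (AssocGraded I) :=
  inferInstanceAs (CommRing (reesAlgebra I ⧸ I.map (algebraMap A (reesAlgebra I))))

instance (I : Ideal A) : Algebra A (AssocGraded I) :=
  inferInstanceAs (Algebra A (reesAlgebra I ⧸ I.map (algebraMap A (reesAlgebra I))))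

/-- The quotient map `⨁ Iⁿ → ⨁ Iⁿ / Iⁿ⁺¹`. -/
def AssocGraded.mk (I : Ideal A) : reesAlgebra I →+* AssocGraded I :=
  Ideal.Quotient.mk (I.map (algebraMap A (reesAlgebra I)))

lemma AssocGraded.mk_surjective (I : Ideal A) : Function.Surjective (AssocGraded.mk I) :=
  Ideal.Quotient.mk_surjective

lemma AssocGraded.ker_mk (I : Ideal A) :
    RingHom.ker (AssocGraded.mk I) = I.map (algebraMap A (reesAlgebra I)) :=
  Ideal.mk_ker

lemma AssocGraded.mk_algebraMap (I : Ideal A) (a : A) :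
    AssocGraded.mk I (algebraMap A _ a) = algebraMap A _ a := rfl

lemma reesMap_algebraMap (φ : A →+* B) {I : Ideal A} {J : Ideal B} (h : I.map φ ≤ J) (a : A) :
    reesMap φ h (algebraMap A _ a) = algebraMap B _ (φ a) :=
  Subtype.ext (Polynomial.map_C φ)

lemma reesMap_comp_algebraMap (φ : A →+* B) {I : Ideal A} {J : Ideal B} (h : I.map φ ≤ J) :
    (reesMap φ h).comp (algebraMap A (reesAlgebra I)) = (algebraMap B (reesAlgebra J)).comp φ :=
  RingHom.ext (reesMap_algebraMap φ h)

lemma map_le_comap_reesMap (φ : A →+* B) {I : Ideal A} {J : Ideal B} (h : I.map φ ≤ J) :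
    I.map (algebraMap A (reesAlgebra I)) ≤
      (J.map (algebraMap B (reesAlgebra J))).comap (reesMap φ h) := by
  rw [← Ideal.map_le_iff_le_comap, Ideal.map_map, reesMap_comp_algebraMap, ← Ideal.map_map]
  exact Ideal.map_mono h

/-- The map of associated graded rings induced by a ring map sending `I` into `J`. -/
def AssocGraded.map (φ : A →+* B) {I : Ideal A} {J : Ideal B} (h : I.map φ ≤ J) :
    AssocGraded I →+* AssocGraded J :=
  Ideal.quotientMap _ (reesMap φ h) (map_le_comap_reesMap φ h)

lemma AssocGraded.map_mk (φ : A →+* B) {I : Ideal A} {J : Ideal B} (h : I.map φ ≤ J)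
    (p : reesAlgebra I) :
    AssocGraded.map φ h (AssocGraded.mk I p) = AssocGraded.mk J (reesMap φ h p) := rfl

lemma AssocGraded.map_algebraMap (φ : A →+* B) {I : Ideal A} {J : Ideal B} (h : I.map φ ≤ J)
    (a : A) : AssocGraded.map φ h (algebraMap A _ a) = algebraMap B _ (φ a) := by
  rw [← mk_algebraMap, map_mk, reesMap_algebraMap, mk_algebraMap]

lemma exists_pow_mul_eq_reesMap [Algebra A B] (f : A) [IsLocalization.Away f B] (I : Ideal A)
    {J : Ideal B} (h : I.map (algebraMap A B) = J) (p : reesAlgebra J) :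
    ∃ (n : ℕ) (q : reesAlgebra I),
      p * algebraMap B _ (algebraMap A B (f ^ n)) = reesMap (algebraMap A B) h.le q := by
  suffices H : ∀ s : Finset ℕ, ∃ (n : ℕ) (q : reesAlgebra I),
      (∑ i ∈ s, monomial i ((p : B[X]).coeff i)) * C (algebraMap A B (f ^ n)) =
        (q : A[X]).map (algebraMap A B) by
    obtain ⟨n, q, e⟩ := H (p : B[X]).support
    refine ⟨n, q, Subtype.ext ?_⟩
    rw [← Polynomial.as_sum_support] at e
    exact e
  intro s
  induction s using Finset.induction_on with
  | empty => exact ⟨0, 0, by simp⟩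
  | insert i s hi ih =>
    obtain ⟨n, q, e⟩ := ih
    have hp : (p : B[X]).coeff i ∈ (I ^ i).map (algebraMap A B) := by
      rw [Ideal.map_pow, h]; exact p.2 i
    obtain ⟨⟨a, ⟨_, m, rfl⟩⟩, ha⟩ :=
      (IsLocalization.mem_map_algebraMap_iff (Submonoid.powers f) B).mp hp
    refine ⟨n + m, algebraMap A _ (f ^ n) * ⟨monomial i a.1, reesAlgebra.monomial_mem.mpr a.2⟩ +
      algebraMap A _ (f ^ m) * q, ?_⟩
    dsimp only at ha
    have e2 : monomial i ((p : B[X]).coeff i) * C (algebraMap A B (f ^ m)) =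
        (monomial i a.1).map (algebraMap A B) := by
      rw [monomial_mul_C, ha, map_monomial]
    have c : ∀ a : A, ((algebraMap A (reesAlgebra I) a : reesAlgebra I) : A[X]) = C a :=
      fun _ ↦ rfl
    rw [Finset.sum_insert hi, Subalgebra.coe_add, Subalgebra.coe_mul, Subalgebra.coe_mul, c, c,
      Polynomial.map_add, Polynomial.map_mul, Polynomial.map_mul, ← e, ← e2, Polynomial.map_C,
      Polynomial.map_C, pow_add, map_mul, C_mul]
    ring

lemma isLocalization_reesMap [Algebra A B] (f : A) [IsLocalization.Away f B] (I : Ideal A)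
    {J : Ideal B} (h : I.map (algebraMap A B) = J) :
    letI := (reesMap (algebraMap A B) h.le).toAlgebra
    IsLocalization.Away (algebraMap A (reesAlgebra I) f) (reesAlgebra J) := by
  let := (reesMap (algebraMap A B) h.le).toAlgebra
  have key : ∀ a : A, algebraMap (reesAlgebra I) (reesAlgebra J) (algebraMap A _ a) =
      algebraMap B _ (algebraMap A B a) := reesMap_algebraMap _ _
  refine ⟨?_, ?_, ?_⟩
  · rintro ⟨_, n, rfl⟩
    dsimp only
    rw [← map_pow, key]
    exact ((IsLocalization.map_units B (⟨f ^ n, n, rfl⟩ : Submonoid.powers f))).map _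
  · intro p
    obtain ⟨n, q, e⟩ := exists_pow_mul_eq_reesMap f I h p
    refine ⟨⟨q, ⟨_, n, rfl⟩⟩, ?_⟩
    dsimp only
    rw [← map_pow, key]
    exact e
  · intro p q e
    have e' : (p : A[X]).map (algebraMap A B) = (q : A[X]).map (algebraMap A B) :=
      congr_arg Subtype.val e
    let := Polynomial.algebra A B
    have := Polynomial.isLocalization (Submonoid.powers f) B
    obtain ⟨⟨_, _, ⟨n, rfl⟩, rfl⟩, hc⟩ := IsLocalization.exists_of_eq
      (M := (Submonoid.powers f).map (C : A →+* A[X])) (S := B[X]) (x := (p : A[X]))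
      (y := (q : A[X])) e'
    refine ⟨⟨_, n, rfl⟩, Subtype.ext ?_⟩
    dsimp only
    rw [← map_pow]
    exact hc

lemma AssocGraded.isLocalization_map [Algebra A B] (f : A) [IsLocalization.Away f B] (I : Ideal A)
    {J : Ideal B} (h : I.map (algebraMap A B) = J) :
    letI := (AssocGraded.map (algebraMap A B) h.le).toAlgebra
    IsLocalization.Away (algebraMap A (AssocGraded I) f) (AssocGraded J) := by
  let := (reesMap (algebraMap A B) h.le).toAlgebra
  let := (AssocGraded.map (algebraMap A B) h.le).toAlgebra
  have := isLocalization_reesMap f I h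
  rw [← AssocGraded.mk_algebraMap, IsLocalization.Away, ← Submonoid.map_powers]
  refine IsLocalization.of_surjective _ (reesAlgebra J) _ (AssocGraded.mk_surjective I)
    (AssocGraded.mk J) (AssocGraded.mk_surjective J) rfl ?_
  rw [AssocGraded.ker_mk, AssocGraded.ker_mk, Ideal.map_map, RingHom.algebraMap_toAlgebra,
    reesMap_comp_algebraMap, ← Ideal.map_map, h]

end Algebra

namespace AlgebraicGeometry.Scheme
open AffineZariskiSite

variable {X Y : Scheme.{u}}

noncomputable section
namespace IdealSheafData
variable (I : Y.IdealSheafData)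

/-- The quasi-coherent sheaf of algebras `⨁ Iⁿ / Iⁿ⁺¹`, given by its values on affine opens. -/
def grDiagram : Y.AffineZariskiSiteᵒᵖ ⥤ CommRingCat.{u} where
  obj U := .of (AssocGraded (I.ideal ⟨U.unop.1, U.unop.2⟩))
  map {U V} i := CommRingCat.ofHom <| AssocGraded.map
    (Y.presheaf.map ((toOpensFunctor Y).map i.unop).op).hom
    (I.map_ideal' (U := ⟨V.unop.1, V.unop.2⟩) (V := ⟨U.unop.1, U.unop.2⟩) _).le
  map_id U := by
    ext x
    obtain ⟨p, rfl⟩ := AssocGraded.mk_surjective _ x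
    refine congr_arg (AssocGraded.mk _) (Subtype.ext (Polynomial.ext fun n ↦ ?_))
    refine (Polynomial.coeff_map _ _).trans ?_
    exact congr($(Y.presheaf.map_id (.op U.unop.1)) _)
  map_comp {U V W} i j := by
    ext x
    obtain ⟨p, rfl⟩ := AssocGraded.mk_surjective _ x
    refine congr_arg (AssocGraded.mk _) (Subtype.ext (Polynomial.ext fun n ↦ ?_))
    refine (Polynomial.coeff_map _ _).trans (.trans ?_ (Polynomial.coeff_map _ _).symm)
    refine .trans ?_ (congr_arg _ (Polynomial.coeff_map _ _).symm)
    exact congr($(Y.presheaf.map_comp ((toOpensFunctor Y).map i.unop).op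
      ((toOpensFunctor Y).map j.unop).op) _)

/-- The structure map `𝒪_Y → ⨁ Iⁿ / Iⁿ⁺¹`. -/
def grDiagramMap : (toOpensFunctor Y).op ⋙ Y.presheaf ⟶ I.grDiagram where
  app U := CommRingCat.ofHom (algebraMap Γ(Y, U.unop.1) (AssocGraded (I.ideal ⟨U.unop.1, U.unop.2⟩)))
  naturality U V i := by
    ext x
    exact (AssocGraded.map_algebraMap _ _ x).symm

lemma coequifibered_grDiagramMap : I.grDiagramMap.Coequifibered := by
  refine coequifibered_iff_forall_isLocalizationAway.mpr fun U r ↦ ?_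
  let := (Y.presheaf.map (homOfLE (Y.basicOpen_le r)).op).hom.toAlgebra
  have : IsLocalization.Away r Γ(Y, Y.basicOpen r) := U.2.isLocalization_basicOpen _
  exact AssocGraded.isLocalization_map r (I.ideal ⟨U.1, U.2⟩)
    (J := I.ideal ⟨Y.basicOpen r, U.2.basicOpen r⟩) (I.map_ideal' _)

/-- The normal cone `C_X Y = Spec_Y (⨁ Iⁿ / Iⁿ⁺¹)` of the closed subscheme `X` of `Y` with ideal
sheaf `I`, glued from its restrictions to the affine opens of `Y`. -/
def normalCone : Scheme.{u} := (relativeGluingData I.coequifibered_grDiagramMap).glued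

/-- The structure morphism of the normal cone; its image is `X`. -/
def normalConeMap : I.normalCone ⟶ Y := (relativeGluingData I.coequifibered_grDiagramMap).toBase

/-- The distinguished varieties of `X` in `Y`: the supports in `Y` (that is, the images) of the
irreducible components of the normal cone `C_X Y`. -/
def distinguishedVarieties : Set (Set Y) :=
  {Z | ∃ C ∈ irreducibleComponents I.normalCone, Z = I.normalConeMap '' C}

/-- The closed subscheme with this ideal sheaf is an effective Cartier divisor: its ideal is
locally generated by one nonzerodivisor. -/
def IsEffectiveCartier : Prop :=
  ∀ y : Y, ∃ U : Y.affineOpens, y ∈ U.1 ∧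
    ∃ f ∈ nonZeroDivisors Γ(Y, U.1), I.ideal U = Ideal.span {f}

end IdealSheafData

/-- `π : Ỹ ⟶ Y` is the blowup of `Y` along the closed subscheme with ideal sheaf `I`: the inverse
image of this subscheme is an effective Cartier divisor, and `π` is universal with this property. -/
structure IsBlowup {Y' Y : Scheme.{u}} (π : Y' ⟶ Y) (I : Y.IdealSheafData) : Prop where
  isEffectiveCartier : (I.comap π).IsEffectiveCartier
  existsUnique {T : Scheme.{u}} (g : T ⟶ Y) (hg : (I.comap g).IsEffectiveCartier) :
    ∃! h : T ⟶ Y', h ≫ π = g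

/-- Let `π` be the blowup of `Y` along `X` and `ρ` the blowup of a closed subscheme `K` of `Y` along
`X ∩ K`. This is the canonical morphism from the latter (the proper transform of `K`) to the
former, that is, the unique morphism over `Y`. -/
def properTransformMap {Y Y' K' : Scheme.{u}} {I K : Y.IdealSheafData} {π : Y' ⟶ Y}
    {ρ : K' ⟶ K.subscheme} (hπ : IsBlowup π I) (hρ : IsBlowup ρ (I.comap K.subschemeι)) :
    K' ⟶ Y' :=
  (hπ.existsUnique (ρ ≫ K.subschemeι) (by
    rw [IdealSheafData.comap_comp]; exact hρ.isEffectiveCartier)).choose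

lemma properTransformMap_comp {Y Y' K' : Scheme.{u}} {I K : Y.IdealSheafData} {π : Y' ⟶ Y}
    {ρ : K' ⟶ K.subscheme} (hπ : IsBlowup π I) (hρ : IsBlowup ρ (I.comap K.subschemeι)) :
    properTransformMap hπ hρ ≫ π = ρ ≫ K.subschemeι :=
  (hπ.existsUnique (ρ ≫ K.subschemeι) (by
    rw [IdealSheafData.comap_comp]; exact hρ.isEffectiveCartier)).choose_spec.1

/-- The fundamental cycle `[W]` of a closed subscheme `i : W ⟶ V`, as a function on the points
of `V`: the coefficient of the closed subvariety with generic point `v` is the length of the local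
ring of `W` at `v` if `v` is the generic point of an irreducible component of `W`, and is zero
otherwise. (The sum has at most one term.) -/
def fundamentalCycle {W V : Scheme.{u}} (i : W ⟶ V) (v : V) : ℕ∞ :=
  ∑ᶠ w ∈ {w : W | i w = v ∧ w ∈ genericPoints W},
    Module.length (W.presheaf.stalk w) (W.presheaf.stalk w)

/-- A scheme has no embedded points if each of its associated points (those at which the
maximal ideal of the local ring is an associated prime) is the generic point of an irreducible
component. -/
def HasNoEmbeddedPoints (W : Scheme.{u}) : Prop :=
  ∀ w : W, IsLocalRing.maximalIdeal (W.presheaf.stalk w) ∈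
    associatedPrimes (W.presheaf.stalk w) (W.presheaf.stalk w) → w ∈ genericPoints W

end
end AlgebraicGeometry.Scheme

/-! ### The affine blowup algebra and the minimal primes of the associated graded ring. -/

section Algebra

variable {A : Type u} [CommRing A]

/-! Write `W` for the total transform and `E` for the exceptional divisor. The proper transform is
always the part of `W` that remains after saturating its ideal with respect to the ideal of `E`. By
the two universal properties, `K'` is universal among schemes over `Y'` that map into `W` and on
which `E` is effective Cartier (`exists_comp_properTransformMap_eq`). The subscheme cut out by the
saturation has the same property, so `j` is isomorphic to its inclusion
(`isClosedImmersion_properTransformMap`). In particular `K'` and `W` agree away from `E`.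

What must be shown is that no component of `W` lies in `E`
(`IsBlowup.notMem_support_of_mem_genericPoints`). In a chart `A[I/s]`, the generic point of a
component of `W` is a prime `P` minimal over the local equation `f` of `K`, so it has height at most
one by Krull. If `P` contains the nonzerodivisor `s`, it is also minimal over `s`, that is, a
component of `E`. Since `E` is the projectivized normal cone, `P` yields a minimal prime of `gr_I A`
containing `f` (`exists_mem_minimalPrimes_assocGraded`), so a distinguished variety would lie in
`K`.

Hence the generic points of `W` lie in the open set where `K'` and `W` agree. This gives equality of
supports and, comparing stalks there, of cycles. Without embedded points, every associated point of
`W` avoids `E`, so `E` is Cartier on `W` and `W` itself factors through `K'`. -/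

/-- The affine blowup algebra `A[I/s]`: the image of `⨁ Iⁿ` in `A_s` under `X ↦ 1 / s`. -/
noncomputable def affineBlowup (I : Ideal A) (s : A) : Subalgebra A (Localization.Away s) :=
  (reesAlgebra I).map (aeval (IsLocalization.Away.invSelf s))

namespace affineBlowup

variable {I : Ideal A} {s : A}

lemma pow_mul_invSelf_pow (s : A) (n : ℕ) : algebraMap A (Localization.Away s) s ^ n *
    (IsLocalization.Away.invSelf s : Localization.Away s) ^ n = 1 := by
  rw [← mul_pow, IsLocalization.Away.mul_invSelf, one_pow]

/-- An element is a sum of fractions `pᵢ / sⁱ` with `pᵢ ∈ Iⁱ`. Over the common denominator `s ^ d`,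
with `d` the degree, each numerator `s ^ (d - i) * pᵢ` lies in `I ^ d` because `s ∈ I`. -/
lemma exists_pow_mul_eq_of_mem (hs : s ∈ I) {x : Localization.Away s} (hx : x ∈ affineBlowup I s) :
    ∃ n, ∃ a ∈ I ^ n, algebraMap A _ (s ^ n) * x = algebraMap A _ a := by
  obtain ⟨p, hp, rfl⟩ := hx
  replace hp : ∀ i, p.coeff i ∈ I ^ i := hp
  refine ⟨p.natDegree, ∑ i ∈ Finset.range (p.natDegree + 1),
    s ^ (p.natDegree - i) * p.coeff i, ?_, ?_⟩
  · refine sum_mem fun i hi ↦ ?_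
    rw [← Nat.sub_add_cancel (Finset.mem_range_succ_iff.mp hi), pow_add]
    exact Ideal.mul_mem_mul (by simpa using Ideal.pow_mem_pow hs _) (by simpa using hp _)
  · change algebraMap A _ _ * aeval _ p = _
    rw [aeval_eq_sum_range, Finset.mul_sum, map_sum]
    refine Finset.sum_congr rfl fun i hi ↦ ?_
    have h := pow_mul_invSelf_pow s i
    have e : s ^ p.natDegree = s ^ (p.natDegree - i) * s ^ i := by
      rw [← pow_add, Nat.sub_add_cancel (Finset.mem_range_succ_iff.mp hi)]
    rw [e, Algebra.smul_def]
    simp only [map_mul, map_pow]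
    linear_combination (algebraMap A (Localization.Away s) s) ^ (p.natDegree - i) *
      algebraMap A _ (p.coeff i) * h

lemma exists_pow_mul_eq (hs : s ∈ I) (b : affineBlowup I s) :
    ∃ n, ∃ a ∈ I ^ n, algebraMap A (affineBlowup I s) s ^ n * b = algebraMap A _ a := by
  obtain ⟨n, a, ha, e⟩ := exists_pow_mul_eq_of_mem hs b.2
  refine ⟨n, a, ha, Subtype.ext ?_⟩
  rw [← map_pow]
  exact e

lemma exists_eq_pow_mul {n : ℕ} {a : A} (ha : a ∈ I ^ n) :
    ∃ b : affineBlowup I s, algebraMap A _ s ^ n * b = algebraMap A _ a := by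
  refine ⟨⟨_, monomial n a, reesAlgebra.monomial_mem.mpr ha, rfl⟩, Subtype.ext ?_⟩
  rw [← map_pow]
  change algebraMap A _ _ * aeval _ (monomial n a) = algebraMap A (Localization.Away s) a
  rw [aeval_monomial, map_pow]
  linear_combination algebraMap A _ a * pow_mul_invSelf_pow s n

lemma algebraMap_mem_nonZeroDivisors :
    algebraMap A (affineBlowup I s) s ∈ nonZeroDivisors (affineBlowup I s) := by
  rw [mem_nonZeroDivisors_iff_right]
  intro b hb
  have h := congr_arg Subtype.val hb
  refine Subtype.ext ((IsLocalization.Away.algebraMap_isUnit (S := Localization.Away s) s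
    ).mul_left_eq_zero.mp h)

lemma exists_pow_mul_eq_zero {a : A} (ha : algebraMap A (affineBlowup I s) a = 0) :
    ∃ n, s ^ n * a = 0 := by
  have h : algebraMap A (Localization.Away s) a = 0 := congr_arg Subtype.val ha
  obtain ⟨⟨_, n, rfl⟩, h⟩ := (IsLocalization.map_eq_zero_iff (Submonoid.powers s) _ a).mp h
  exact ⟨n, h⟩

lemma map_eq_span (hs : s ∈ I) :
    I.map (algebraMap A (affineBlowup I s)) = Ideal.span {algebraMap A _ s} := by
  refine le_antisymm (Ideal.map_le_iff_le_comap.mpr fun a ha ↦ ?_)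
    ((Ideal.span_singleton_le_iff_mem _).mpr (Ideal.mem_map_of_mem _ hs))
  obtain ⟨b, hb⟩ := exists_eq_pow_mul (s := s) (n := 1) (a := a) (by simpa using ha)
  exact Ideal.mem_span_singleton.mpr ⟨b, by rw [← hb, pow_one]⟩

instance [IsNoetherianRing A] : IsNoetherianRing (affineBlowup I s) := by
  let φ : reesAlgebra I →+* affineBlowup I s :=
    ((aeval (IsLocalization.Away.invSelf s : Localization.Away s)).toRingHom).restrict
      (reesAlgebra I) (affineBlowup I s) fun p hp ↦ ⟨p, hp, rfl⟩
  refine isNoetherianRing_of_surjective _ _ φ ?_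
  rintro ⟨_, p, hp, rfl⟩
  exact ⟨⟨p, hp⟩, rfl⟩

end affineBlowup

lemma coeff_mem_of_mem_map_reesAlgebra {I : Ideal A} {p : reesAlgebra I}
    (hp : p ∈ I.map (algebraMap A (reesAlgebra I))) (i : ℕ) : (p : A[X]).coeff i ∈ I ^ (i + 1) := by
  induction hp using Submodule.span_induction generalizing i with
  | mem x hx =>
    obtain ⟨a, ha, rfl⟩ := hx
    change (C a : A[X]).coeff i ∈ _
    rw [coeff_C]
    split_ifs with h
    · simpa [h] using ha
    · exact zero_mem _
  | zero => exact zero_mem _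
  | add x y _ _ hx hy =>
    rw [Subalgebra.coe_add, coeff_add]
    exact add_mem (hx i) (hy i)
  | smul r x _ hx =>
    rw [smul_eq_mul, Subalgebra.coe_mul, coeff_mul]
    refine sum_mem fun ij hij ↦ ?_
    rw [← Finset.HasAntidiagonal.mem_antidiagonal.mp hij, add_assoc, pow_add]
    exact Ideal.mul_mem_mul (r.2 _) (hx _)

/-- Krull's principal ideal theorem bounds the height of `P` by one, while a nonzerodivisor
generates an ideal of height at least one, so no prime fits strictly between. -/
lemma Ideal.mem_minimalPrimes_span_of_mem_nonZeroDivisors {B : Type*} [CommRing B]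
    [IsNoetherianRing B] {f s : B} {P : Ideal B} (hP : P ∈ (Ideal.span {f}).minimalPrimes)
    (hs : s ∈ nonZeroDivisors B) (hsP : s ∈ P) : P ∈ (Ideal.span {s}).minimalPrimes := by
  have := hP.isPrime
  have h1 := Ideal.height_le_one_of_isPrincipal_of_mem_minimalPrimes _ P hP
  have : P.FiniteHeight := ⟨.inr (ne_top_of_le_ne_top ENat.one_ne_top h1)⟩
  exact Ideal.mem_minimalPrimes_of_height_le ((Ideal.span_singleton_le_iff_mem _).mpr hsP)
    (h1.trans (Ideal.one_le_height_span_singleton_of_mem_nonZeroDivisors hs))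

open affineBlowup in
/-- A minimal prime over `s` of `A[I/s]` comes from a minimal prime of `gr_I A`. -/
lemma exists_mem_minimalPrimes_assocGraded {I : Ideal A} {s : A} (hs : s ∈ I)
    {P : Ideal (affineBlowup I s)}
    (hP : P ∈ (Ideal.span {algebraMap A (affineBlowup I s) s}).minimalPrimes) {f : A}
    (hf : algebraMap A _ f ∈ P) :
    ∃ Q ∈ minimalPrimes (AssocGraded I), algebraMap A _ f ∈ Q := by
  have hPp := hP.isPrime
  have hsP : algebraMap A (affineBlowup I s) s ∈ P := hP.1.2 (Ideal.mem_span_singleton_self _)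
  have hs0 : algebraMap A (affineBlowup I s) s ∈ nonZeroDivisors _ :=
    algebraMap_mem_nonZeroDivisors
  have cancel {n : ℕ} {x y : affineBlowup I s}
      (h : algebraMap A _ s ^ n * x = algebraMap A _ s ^ n * y) : x = y :=
    (mul_cancel_left_mem_nonZeroDivisors (pow_mem hs0 n)).mp h
  -- The homogeneous elements `a Xⁿ` whose fraction `a / sⁿ` lies outside `P`. A prime of the Rees
  -- algebra avoiding them plays the role of the homogeneous prime attached to `P`.
  let S : Submonoid (reesAlgebra I) :=
  { carrier := {p | ∃ n, ∃ a : A, ∃ b ∉ P, algebraMap A (affineBlowup I s) s ^ n * b =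
      algebraMap A _ a ∧ (p : A[X]) = monomial n a}
    one_mem' := ⟨0, 1, 1, hPp.one_notMem, by simp, rfl⟩
    mul_mem' := by
      rintro p q ⟨n, a, b, hb, hab, hp⟩ ⟨n', a', b', hb', hab', hq⟩
      refine ⟨n + n', a * a', b * b', fun h ↦ (hPp.mem_or_mem h).elim hb hb', ?_, ?_⟩
      · rw [map_mul, ← hab, ← hab']; ring
      · rw [Subalgebra.coe_mul, hp, hq, monomial_mul_monomial] }
  have hdisj : Disjoint (I.map (algebraMap A (reesAlgebra I)) : Set (reesAlgebra I)) S := by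
    rw [Set.disjoint_left]
    rintro p hp ⟨n, a, b, hb, hab, e⟩
    have ha := coeff_mem_of_mem_map_reesAlgebra hp n
    rw [e, coeff_monomial, if_pos rfl] at ha
    -- If `a ∈ I ^ (n + 1)`, then `a / sⁿ` is `s` times an element of `A[I/s]`, hence lies in `P`.
    obtain ⟨c, hc⟩ := exists_eq_pow_mul (s := s) ha
    rw [← hab, pow_succ, mul_assoc] at hc
    exact hb (cancel hc ▸ P.mul_mem_right c hsP)
  obtain ⟨Q₁, hQ₁, hle, hQ₁S⟩ := Ideal.exists_le_prime_disjoint _ S hdisj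
  obtain ⟨Q₀, hQ₀, hQ₀₁⟩ := Ideal.exists_minimalPrimes_le hle
  have hQS (p) (hp : p ∈ S) : p ∉ Q₀ := fun h ↦ Set.disjoint_left.mp hQ₁S (hQ₀₁ h) hp
  have hQp := hQ₀.isPrime
  have hfQ : algebraMap A (reesAlgebra I) f ∈ Q₀ := by
    -- Minimality of `P` over `s` makes `f` nilpotent modulo `s` after localizing at `P`. The
    -- resulting relation `g fⁿ = s d` is then cleared of denominators and homogenized in the Rees
    -- algebra.
    obtain ⟨g, hg, n, hn⟩ : ∃ g ∉ P, ∃ n, g * algebraMap A _ f ^ n ∈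
        Ideal.span {algebraMap A (affineBlowup I s) s} := by
      have h := Ideal.mem_map_of_mem (algebraMap _ (Localization.AtPrime P)) hf
      rw [← IsLocalization.AtPrime.radical_map_of_mem_minimalPrimes _ P _ hP] at h
      obtain ⟨n, hn⟩ := h
      rw [← map_pow, IsLocalization.algebraMap_mem_map_algebraMap_iff P.primeCompl] at hn
      obtain ⟨g, hg, hn⟩ := hn
      exact ⟨g, hg, n, hn⟩
    obtain ⟨d, hd⟩ := Ideal.mem_span_singleton.mp hn
    obtain ⟨m, a, ha, hga⟩ := exists_pow_mul_eq hs g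
    obtain ⟨k, c, hc, hdc⟩ := exists_pow_mul_eq hs d
    have h0 : algebraMap A (affineBlowup I s) (s ^ k * a * f ^ n - s ^ (m + 1) * c) = 0 := by
      simp only [map_sub, map_mul, map_pow, ← hga, ← hdc]
      linear_combination algebraMap A _ s ^ (k + m) * hd
    obtain ⟨N, hN⟩ := exists_pow_mul_eq_zero h0
    let σ : reesAlgebra I := ⟨monomial 1 s, reesAlgebra.monomial_mem.mpr (by simpa using hs)⟩
    let α : reesAlgebra I := ⟨monomial m a, reesAlgebra.monomial_mem.mpr ha⟩
    let γ : reesAlgebra I := ⟨monomial k c, reesAlgebra.monomial_mem.mpr hc⟩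
    have hσ : σ ∉ Q₀ := hQS _ ⟨1, s, 1, hPp.one_notMem, by simp, rfl⟩
    have hα : α ∉ Q₀ := hQS _ ⟨m, a, g, hg, hga, rfl⟩
    -- Both sides have degree `N + k + m`. The right side has a factor `s` in degree zero, so it
    -- lies in `Q₀`, while `σ` and `α` belong to `S` and hence do not.
    have key : σ ^ (N + k) * α * algebraMap A _ f ^ n =
        algebraMap A _ s * (σ ^ (N + m) * γ) := by
      refine Subtype.ext ?_
      rw [← map_pow]
      change (monomial 1 s) ^ (N + k) * monomial m a * C (f ^ n) =
        C s * ((monomial 1 s) ^ (N + m) * monomial k c)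
      rw [monomial_pow, monomial_pow, monomial_mul_monomial, monomial_mul_monomial, monomial_mul_C,
        C_mul_monomial, one_mul, one_mul, add_right_comm]
      congr 1
      linear_combination hN
    have hmem : σ ^ (N + k) * α * algebraMap A _ f ^ n ∈ Q₀ := by
      rw [key]
      exact Q₀.mul_mem_right _ (hQ₀.1.2 (Ideal.mem_map_of_mem _ hs))
    refine hQp.mem_of_pow_mem n ((hQp.mem_or_mem hmem).resolve_left fun h ↦ ?_)
    exact (hQp.mem_or_mem h).elim (fun h ↦ hσ (hQp.mem_of_pow_mem _ h)) hα
  rw [Ideal.minimalPrimes_eq_comap] at hQ₀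
  obtain ⟨Q, hQ, rfl⟩ := hQ₀
  exact ⟨Q, hQ, hfQ⟩

end Algebra

/-! ### Pullback of ideal sheaves on affine opens. -/

namespace AlgebraicGeometry.Scheme

variable {X Y : Scheme.{u}}

namespace IdealSheafData

/-- By adjunction: test both sides against an arbitrary ideal, using that `comap` is left adjoint to
`map` and that `map` between affine schemes is contraction of ideals. -/
lemma ideal_comap_top [IsAffine X] [IsAffine Y] (J : Y.IdealSheafData) (f : X ⟶ Y) :
    (J.comap f).ideal ⟨⊤, isAffineOpen_top X⟩ =
      (J.ideal ⟨⊤, isAffineOpen_top Y⟩).map f.appTop.hom := by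
  refine eq_of_forall_ge_iff fun K ↦ ?_
  have h : (ofIdealTop K).ideal ⟨⊤, isAffineOpen_top X⟩ = K := by simp
  rw [Ideal.map_le_iff_le_comap]
  trans J.comap f ≤ ofIdealTop K
  · exact ⟨fun H ↦ le_of_isAffine (by rwa [h]), fun H ↦ (H _).trans h.le⟩
  rw [← le_map_iff_comap_le]
  have h' : ((ofIdealTop K).map f).ideal ⟨⊤, isAffineOpen_top Y⟩ = K.comap f.appTop.hom := by
    rw [ideal_map_of_isAffineHom]
    exact congr_arg (Ideal.comap _) h
  exact ⟨fun H ↦ (H _).trans h'.le, fun H ↦ le_of_isAffine (by rwa [h'])⟩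

lemma ideal_comap_opens_ι_top (I : Y.IdealSheafData) (U : Y.affineOpens) :
    (I.comap U.1.ι).ideal ⟨⊤, have : IsAffine U.1 := U.2; isAffineOpen_top _⟩ =
      (I.ideal U).map U.1.topIso.inv.hom := by
  have h : IsAffineOpen (U.1.ι ''ᵁ ⊤) := IsAffineOpen.image_of_isOpenImmersion
    (have : IsAffine U.1 := U.2; isAffineOpen_top _) _
  have h1 := I.map_ideal' (V := U) (U := ⟨_, h⟩) (homOfLE (U.1.ι_image_le ⊤)).op
  have h2 : U.1.topIso.inv = Y.presheaf.map (homOfLE (U.1.ι_image_le ⊤)).op := rfl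
  rw [ideal_comap_of_isOpenImmersion, h2]
  refine Eq.trans ?_ h1.symm
  simp only [Opens.ι_appIso, Iso.refl_inv]
  erw [CommRingCat.hom_id, Ideal.comap_id]

lemma ideal_comap (I : Y.IdealSheafData) (f : X ⟶ Y) (U : Y.affineOpens) (V : X.affineOpens)
    (e : V.1 ≤ f ⁻¹ᵁ U.1) :
    (I.comap f).ideal V = (I.ideal U).map (f.appLE U V e).hom := by
  have : IsAffine U.1 := U.2
  have : IsAffine V.1 := V.2
  have h1 := (I.comap f).ideal_comap_opens_ι_top V
  have h2 := ideal_comap_top (I.comap U.1.ι) (f.resLE U V e)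
  rw [← comap_comp, Hom.resLE_comp_ι, comap_comp, h1, ideal_comap_opens_ι_top,
    show (f.resLE U V e).appTop = _ from Hom.resLE_app_top .., Ideal.map_map,
    ← CommRingCat.hom_comp, Iso.inv_hom_id_assoc, CommRingCat.hom_comp, ← Ideal.map_map] at h2
  have h3 := congr_arg (Ideal.map V.1.topIso.hom.hom) h2
  simpa only [Ideal.map_map, ← CommRingCat.hom_comp, Iso.inv_hom_id, Category.assoc, Category.comp_id,
    CommRingCat.hom_id, Ideal.map_id] using h3

end IdealSheafData
end AlgebraicGeometry.Scheme

/-! ### The universal property of the affine blowup algebra. -/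

section Algebra

variable {A C : Type u} [CommRing A] [CommRing C]

lemma mem_nonZeroDivisors_of_span_eq {R : Type*} [CommRing R] {a b : R}
    (h : Ideal.span {a} = Ideal.span {b}) (ha : a ∈ nonZeroDivisors R) :
    b ∈ nonZeroDivisors R := by
  obtain ⟨c, rfl⟩ := Ideal.mem_span_singleton.mp (h ▸ Ideal.mem_span_singleton_self a)
  exact (mul_mem_nonZeroDivisors.mp ha).1

lemma affineBlowup.map_comp_eq_span {I : Ideal A} {s : A} (hs : s ∈ I)
    (j : affineBlowup I s →+* C) :
    I.map (j.comp (algebraMap A _)) = Ideal.span {j (algebraMap A _ s)} := by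
  rw [← Ideal.map_map, map_eq_span hs, Ideal.map_span, Set.image_singleton]

/-- The universal property of `A[I/s]`. -/
lemma affineBlowup.exists_ringHom {I : Ideal A} {s : A} (hs : s ∈ I) (φ : A →+* C)
    (hφ : φ s ∈ nonZeroDivisors C) (hI : I.map φ ≤ Ideal.span {φ s}) :
    ∃ χ : affineBlowup I s →+* C, χ.comp (algebraMap A _) = φ := by
  let L := Localization.Away (φ s)
  let ι : C →+* L := algebraMap C L
  have hι : Function.Injective ι :=
    IsLocalization.injective L (M := Submonoid.powers (φ s)) (by
      rintro _ ⟨n, rfl⟩; exact pow_mem hφ n)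
  let θ : Localization.Away s →+* L := IsLocalization.Away.map _ _ φ s
  have hθ (a : A) : θ (algebraMap A _ a) = ι (φ a) := IsLocalization.map_eq _ a
  have hu : IsUnit (ι (φ s)) := IsLocalization.Away.algebraMap_isUnit (φ s)
  -- Write `b = a / sⁿ` with `a ∈ Iⁿ`. Then `φ a` is divisible by `φ s ^ n`, so the image of `b` in
  -- the localization already lies in `C`.
  have hθB (b : affineBlowup I s) : (θ.comp (affineBlowup I s).val.toRingHom) b ∈ ι.range := by
    obtain ⟨n, a, ha, e⟩ := exists_pow_mul_eq_of_mem hs b.2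
    have ha' := Ideal.mem_map_of_mem φ ha
    rw [Ideal.map_pow] at ha'
    replace ha' := Ideal.pow_right_mono hI n ha'
    rw [Ideal.span_singleton_pow, Ideal.mem_span_singleton] at ha'
    obtain ⟨c, hc⟩ := ha'
    refine ⟨c, (hu.pow n).mul_left_cancel ?_⟩
    have e' := congr_arg θ e
    rw [map_mul, hθ, hθ, hc, map_mul, map_pow, map_pow] at e'
    exact e'.symm
  let e : C ≃+* ι.range := RingEquiv.ofBijective ι.rangeRestrict
    ⟨fun x y h ↦ hι (congr_arg Subtype.val h), ι.rangeRestrict_surjective⟩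
  refine ⟨e.symm.toRingHom.comp ((θ.comp (affineBlowup I s).val.toRingHom).codRestrict _ hθB),
    RingHom.ext fun a ↦ ?_⟩
  refine (e.symm_apply_eq).mpr (Subtype.ext ?_)
  exact hθ a

lemma affineBlowup.ringHom_ext {I : Ideal A} {s : A} (hs : s ∈ I)
    {α β : affineBlowup I s →+* C} (hα : α (algebraMap A _ s) ∈ nonZeroDivisors C)
    (h : α.comp (algebraMap A _) = β.comp (algebraMap A _)) : α = β := by
  have h' (a : A) : α (algebraMap A _ a) = β (algebraMap A _ a) := congr($h a)
  refine RingHom.ext fun b ↦ ?_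
  obtain ⟨n, a, -, e⟩ := exists_pow_mul_eq hs b
  refine (mul_cancel_left_mem_nonZeroDivisors (pow_mem hα n)).mp ?_
  rw [← map_pow, ← map_mul, e, h', ← e, map_mul, map_pow, map_pow, h']

end Algebra

/-! ### Effective Cartier divisors and the affine charts of a blowup. -/

namespace AlgebraicGeometry.Scheme

variable {X Y : Scheme.{u}}

namespace IdealSheafData

lemma ideal_basicOpen_eq_span {I : Y.IdealSheafData} {U : Y.affineOpens} {f : Γ(Y, U.1)}
    (h : I.ideal U = Ideal.span {f}) (hf : f ∈ nonZeroDivisors Γ(Y, U.1)) (r : Γ(Y, U.1)) :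
    ∃ g ∈ nonZeroDivisors Γ(Y, Y.basicOpen r),
      g = Y.presheaf.map (homOfLE (Y.basicOpen_le r)).op f ∧
      I.ideal (Y.affineBasicOpen r) = Ideal.span {g} := by
  let := (Y.presheaf.map (homOfLE (Y.basicOpen_le r)).op).hom.toAlgebra
  have : IsLocalization.Away r Γ(Y, Y.basicOpen r) := U.2.isLocalization_basicOpen _
  refine ⟨_, IsLocalization.nonZeroDivisors_le_comap (Submonoid.powers r) Γ(Y, Y.basicOpen r) hf,
    rfl, ?_⟩
  rw [← I.map_ideal_basicOpen, h, Ideal.map_span, Set.image_singleton]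
  rfl

lemma IsEffectiveCartier.exists_le {I : Y.IdealSheafData} (hI : I.IsEffectiveCartier) {y : Y}
    {O : Y.Opens} (hy : y ∈ O) : ∃ U : Y.affineOpens, y ∈ U.1 ∧ U.1 ≤ O ∧
      ∃ f ∈ nonZeroDivisors Γ(Y, U.1), I.ideal U = Ideal.span {f} := by
  obtain ⟨U, hU, f, hf, h⟩ := hI y
  obtain ⟨r, hr, hyr⟩ := U.2.exists_basicOpen_le ⟨y, hy⟩ hU
  obtain ⟨g, hg, -, h⟩ := ideal_basicOpen_eq_span h hf r
  exact ⟨Y.affineBasicOpen r, hyr, hr, g, hg, h⟩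

lemma IsEffectiveCartier.comap_of_isOpenImmersion {I : Y.IdealSheafData}
    (hI : I.IsEffectiveCartier) (f : X ⟶ Y) [IsOpenImmersion f] :
    (I.comap f).IsEffectiveCartier := by
  intro x
  obtain ⟨U, hxU, hU, t, ht, e⟩ := hI.exists_le (y := f x) (O := f.opensRange) ⟨x, rfl⟩
  refine ⟨⟨f ⁻¹ᵁ U.1, U.2.preimage_of_isOpenImmersion f hU⟩, hxU, f.app U.1 t, ?_, ?_⟩
  · have : IsIso (f.app U.1) := f.isIso_app U.1 hU
    let e := (asIso (f.app U.1)).commRingCatIsoToRingEquiv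
    exact (MulEquivClass.map_nonZeroDivisors e).le ⟨t, ht, rfl⟩
  · rw [ideal_comap _ _ U _ le_rfl, e, Ideal.map_span, Set.image_singleton, Hom.app_eq_appLE]

lemma IsEffectiveCartier.mem_nonZeroDivisors {I : Y.IdealSheafData} (hI : I.IsEffectiveCartier)
    (s : Γ(Y, ⊤)) (h : ∀ U : Y.affineOpens, I.ideal U =
      Ideal.span {Y.presheaf.map (homOfLE le_top : U.1 ⟶ ⊤).op s}) :
    s ∈ nonZeroDivisors Γ(Y, ⊤) := by
  rw [mem_nonZeroDivisors_iff_right]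
  intro x hx
  choose U hyU f hf hU using hI
  refine Y.sheaf.eq_of_locally_eq' (fun y ↦ (U y).1) ⊤ (fun y ↦ homOfLE le_top)
    (fun y _ ↦ TopologicalSpace.Opens.mem_iSup.mpr ⟨y, hyU y⟩) x 0 fun y ↦ ?_
  have hs := mem_nonZeroDivisors_of_span_eq ((hU y).symm.trans (h (U y))) (hf y)
  have e := congr_arg (Y.presheaf.map (homOfLE le_top : (U y).1 ⟶ ⊤).op) hx
  rw [map_mul, map_zero] at e
  refine ((mem_nonZeroDivisors_iff_right.mp hs) _ e).trans (map_zero _).symm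

end IdealSheafData

open IdealSheafData

lemma fromSpec_appLE_top (U : Y.affineOpens) :
    U.2.fromSpec.appLE U.1 ⊤ U.2.fromSpec_preimage_self.ge = (ΓSpecIso Γ(Y, U.1)).inv := by
  rw [Hom.appLE, U.2.fromSpec_app_self, Category.assoc, ← Functor.map_comp]
  have : (Spec Γ(Y, U.1)).presheaf.map ((eqToHom U.2.fromSpec_preimage_self).op ≫
    (homOfLE U.2.fromSpec_preimage_self.ge).op) = 𝟙 _ := (Spec Γ(Y, U.1)).presheaf.map_id _
  rw [this, Category.comp_id]

lemma ideal_comap_specMap_fromSpec (I : Y.IdealSheafData) (U : Y.affineOpens) {R : CommRingCat.{u}}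
    (ψ : Γ(Y, U.1) ⟶ R) :
    (I.comap (Spec.map ψ ≫ U.2.fromSpec)).ideal ⟨⊤, isAffineOpen_top _⟩ =
      (I.ideal U).map (ψ ≫ (ΓSpecIso R).inv).hom := by
  have h2 := ideal_comap I U.2.fromSpec U ⟨⊤, isAffineOpen_top _⟩ U.2.fromSpec_preimage_self.ge
  rw [comap_comp, ideal_comap_top, h2, fromSpec_appLE_top, Ideal.map_map, ← CommRingCat.hom_comp,
    ← ΓSpecIso_inv_naturality]

/-- The structure morphism of an affine chart `Spec A[I/s]` of the blowup. -/
noncomputable def affineBlowupMap (I : Y.IdealSheafData) (U : Y.affineOpens) (s : Γ(Y, U.1)) :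
    Spec (.of (affineBlowup (I.ideal U) s)) ⟶ Y :=
  Spec.map (CommRingCat.ofHom (algebraMap Γ(Y, U.1) (affineBlowup (I.ideal U) s))) ≫ U.2.fromSpec

section

variable (I : Y.IdealSheafData) (U : Y.affineOpens) {s : Γ(Y, U.1)} (hs : s ∈ I.ideal U)

include hs

lemma ideal_comap_affineBlowupMap_top :
    (I.comap (affineBlowupMap I U s)).ideal ⟨⊤, isAffineOpen_top _⟩ =
      Ideal.span {(ΓSpecIso (.of (affineBlowup (I.ideal U) s))).inv (algebraMap _ _ s)} := by
  refine (ideal_comap_specMap_fromSpec I U (CommRingCat.ofHom (algebraMap Γ(Y, U.1) _))).trans ?_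
  exact affineBlowup.map_comp_eq_span hs (ΓSpecIso (.of (affineBlowup (I.ideal U) s))).inv.hom

lemma isEffectiveCartier_comap_affineBlowupMap :
    (I.comap (affineBlowupMap I U s)).IsEffectiveCartier := fun x ↦ by
  refine ⟨⟨⊤, isAffineOpen_top _⟩, trivial, _, ?_, ideal_comap_affineBlowupMap_top I U hs⟩
  let e := (ΓSpecIso (.of (affineBlowup (I.ideal U) s))).symm.commRingCatIsoToRingEquiv
  exact (MulEquivClass.map_nonZeroDivisors e).le
    ⟨_, affineBlowup.algebraMap_mem_nonZeroDivisors, rfl⟩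

lemma affineBlowupMap_hom_ext {T : Scheme.{u}}
    {a b : T ⟶ Spec (.of (affineBlowup (I.ideal U) s))}
    (h : a ≫ affineBlowupMap I U s = b ≫ affineBlowupMap I U s)
    (hT : (I.comap (a ≫ affineBlowupMap I U s)).IsEffectiveCartier) : a = b := by
  let e := ΓSpecIso (.of (affineBlowup (I.ideal U) s))
  refine ext_of_isAffine ?_
  rw [← cancel_epi e.inv]
  ext1
  refine affineBlowup.ringHom_ext hs ?_ ?_
  · refine hT.mem_nonZeroDivisors _ fun V ↦ ?_
    rw [comap_comp, ideal_comap _ a ⟨⊤, isAffineOpen_top _⟩ V le_top,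
      ideal_comap_affineBlowupMap_top I U hs, Ideal.map_span, Set.image_singleton]
    rfl
  · have h' : a ≫ Spec.map (CommRingCat.ofHom (algebraMap Γ(Y, U.1) (affineBlowup (I.ideal U) s))) =
        b ≫ Spec.map (CommRingCat.ofHom (algebraMap _ _)) := by
      have : IsOpenImmersion U.2.fromSpec := IsAffineOpen.isOpenImmersion_fromSpec U.2
      rw [← cancel_mono U.2.fromSpec]
      simpa only [affineBlowupMap, Category.assoc] using h
    have h2 := congr((ΓSpecIso _).inv ≫ Hom.appTop $h')
    simp only [Hom.comp_appTop] at h2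
    rw [← ΓSpecIso_inv_naturality_assoc, ← ΓSpecIso_inv_naturality_assoc] at h2
    exact congr_arg CommRingCat.Hom.hom h2

end

/-- A blowup is covered by affine charts `Spec A[I/s]`. -/
lemma IsBlowup.exists_chart {Y' : Scheme.{u}} {π : Y' ⟶ Y} {I : Y.IdealSheafData}
    (hπ : IsBlowup π I) (w : Y') (U : Y.affineOpens) (hw : π w ∈ U.1) :
    ∃ s ∈ I.ideal U, ∃ (V : Y'.Opens) (k : V.toScheme ⟶ Spec (.of (affineBlowup (I.ideal U) s))),
      w ∈ V ∧ IsOpenImmersion k ∧ k ≫ affineBlowupMap I U s = V.ι ≫ π := by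
  obtain ⟨V₀, hwV₀, hV₀, t, ht, e₀⟩ := hπ.isEffectiveCartier.exists_le (y := w) (O := π ⁻¹ᵁ U.1) hw
  obtain ⟨s, hs, c, hc, hsc⟩ : ∃ s ∈ I.ideal U, ∃ c : Γ(Y', V₀.1), w ∈ Y'.basicOpen c ∧
      π.appLE U.1 V₀.1 hV₀ s = t * c := by
    let p : Ideal Γ(Y', V₀.1) := (IsLocalRing.maximalIdeal (Y'.presheaf.stalk w)).comap
      (Y'.presheaf.germ V₀.1 w hwV₀).hom
    have hp : p ≠ ⊤ := Ideal.comap_ne_top _ (Ideal.IsPrime.ne_top inferInstance)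
    -- If every quotient `c` vanished at `w`, the pullback of `I`, which is `(t)`, would lie in `(t)
    -- p`; cancelling `t` would put `1` in `p`.
    by_contra! H
    have hle : Ideal.span {t} ≤ Ideal.span {t} * p := by
      conv_lhs => rw [← e₀, ideal_comap _ _ _ _ hV₀]
      refine Ideal.map_le_iff_le_comap.mpr fun x hx ↦ ?_
      have hx' := Ideal.mem_map_of_mem (π.appLE U.1 V₀.1 hV₀).hom hx
      rw [← ideal_comap, e₀, Ideal.mem_span_singleton] at hx'
      obtain ⟨c, hc⟩ := hx'
      refine Ideal.mem_span_singleton_mul.mpr ⟨c, ?_, hc.symm⟩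
      by_contra hcp
      refine H x hx c ((Y'.mem_basicOpen c w hwV₀).mpr ?_) hc
      exact not_not.mp hcp
    obtain ⟨c, hc, hct⟩ := Ideal.mem_span_singleton_mul.mp (hle (Ideal.mem_span_singleton_self t))
    refine hp ((Ideal.eq_top_iff_one _).mpr ?_)
    rwa [← (mul_cancel_left_mem_nonZeroDivisors ht).mp (hct.trans (mul_one t).symm)]
  obtain ⟨g, hg, rfl, hgV⟩ := ideal_basicOpen_eq_span e₀ ht c
  have hVa : IsAffineOpen (Y'.basicOpen c) := V₀.2.basicOpen c
  have hV : (Y'.basicOpen c) ≤ π ⁻¹ᵁ U.1 := (Y'.basicOpen_le c).trans hV₀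
  have hcu : IsUnit (Y'.presheaf.map (homOfLE (Y'.basicOpen_le c)).op c) :=
    RingedSpace.isUnit_res_basicOpen _ _
  have hsV : π.appLE U.1 (Y'.basicOpen c) hV s = Y'.presheaf.map (homOfLE (Y'.basicOpen_le c)).op t *
      Y'.presheaf.map (homOfLE (Y'.basicOpen_le c)).op c := by
    rw [← map_mul, ← hsc, ← Hom.appLE_map _ hV₀ (homOfLE (Y'.basicOpen_le c)).op]
    rfl
  obtain ⟨χ, hχ⟩ := affineBlowup.exists_ringHom hs (π.appLE U.1 (Y'.basicOpen c) hV).hom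
    (by rw [hsV]; exact mul_mem hg hcu.mem_nonZeroDivisors) (by
      have h := (Ideal.span_singleton_mul_right_unit hcu
        (Y'.presheaf.map (homOfLE (Y'.basicOpen_le c)).op t)).ge
      rw [← hsV] at h
      exact ((ideal_comap I π U (Y'.affineBasicOpen c) hV).ge.trans hgV.le).trans h)
  let S := Spec (.of (affineBlowup (I.ideal U) s))
  let q : S ⟶ Y := affineBlowupMap I U s
  let k : (Y'.basicOpen c).toScheme ⟶ S := (Y'.basicOpen c).toSpecΓ ≫ Spec.map (CommRingCat.ofHom χ)
  have hkq : k ≫ q = (Y'.basicOpen c).ι ≫ π := by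
    have : CommRingCat.ofHom (algebraMap Γ(Y, U.1) (affineBlowup (I.ideal U) s)) ≫
      CommRingCat.ofHom χ = π.appLE U.1 (Y'.basicOpen c) hV := by ext1; exact hχ
    change ((Y'.basicOpen c).toSpecΓ ≫ Spec.map (CommRingCat.ofHom χ)) ≫
      Spec.map _ ≫ U.2.fromSpec = _
    rw [Category.assoc, ← Spec.map_comp_assoc, this,
      IsAffineOpen.SpecMap_appLE_fromSpec π U.2 hVa, IsAffineOpen.toSpecΓ_fromSpec_assoc]
  have hq : (I.comap q).IsEffectiveCartier := isEffectiveCartier_comap_affineBlowupMap I U hs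
  -- The universal property of the chart gave `k`, and that of the blowup gives `r` in the other
  -- direction. The two uniqueness statements make them mutually inverse over the open set
  -- `Y'.basicOpen c`.
  obtain ⟨r, hr, -⟩ := hπ.existsUnique q hq
  have hkr : k ≫ r = (Y'.basicOpen c).ι := by
    refine (hπ.existsUnique ((Y'.basicOpen c).ι ≫ π) ?_).unique ?_ rfl
    · rw [comap_comp]
      exact hπ.isEffectiveCartier.comap_of_isOpenImmersion _
    · rw [Category.assoc, hr, hkq]
  let T := r ⁻¹ᵁ (Y'.basicOpen c)
  let l : (Y'.basicOpen c).toScheme ⟶ T.toScheme := IsOpenImmersion.lift T.ι k (by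
    rintro _ ⟨v, rfl⟩
    rw [Opens.range_ι]
    change (k ≫ r) v ∈ (Y'.basicOpen c)
    rw [hkr]
    exact v.2)
  have hl : l ≫ T.ι = k := IsOpenImmersion.lift_fac _ _ _
  have h1 : (r ∣_ (Y'.basicOpen c)) ≫ k = T.ι := by
    have h : ((r ∣_ (Y'.basicOpen c)) ≫ k) ≫ q = T.ι ≫ q := by
      rw [Category.assoc, hkq, morphismRestrict_ι_assoc, hr]
    refine affineBlowupMap_hom_ext I U hs h ?_
    rw [show _ ≫ affineBlowupMap I U s = _ from h, comap_comp]
    exact hq.comap_of_isOpenImmersion _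
  have : IsIso l := by
    refine ⟨r ∣_ (Y'.basicOpen c), ?_, ?_⟩
    · rw [← cancel_mono (Y'.basicOpen c).ι, Category.assoc, morphismRestrict_ι, reassoc_of% hl, hkr,
        Category.id_comp]
    · rw [← cancel_mono T.ι, Category.assoc, hl, h1, Category.id_comp]
  exact ⟨s, hs, (Y'.basicOpen c), k, hc, hl ▸ inferInstance, hkq⟩

end AlgebraicGeometry.Scheme

/-! ### Generic points and specialization. -/

section Topology

variable {α β : Type*} [TopologicalSpace α] [TopologicalSpace β]

lemma mem_genericPoints_iff [QuasiSober α] [T0Space α] {x : α} :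
    x ∈ genericPoints α ↔ ∀ y, y ⤳ x → y = x := by
  refine ⟨fun h y hy ↦ ?_, fun h ↦ ⟨isIrreducible_singleton.closure, fun s hs hxs ↦ ?_⟩⟩
  · have hle : closure {x} ⊆ closure {y} := specializes_iff_closure_subset.mp hy
    exact (specializes_iff_closure_subset.mpr
      (h.2 isIrreducible_singleton.closure hle)).antisymm hy |>.eq.symm
  · obtain ⟨y, hy⟩ := QuasiSober.sober hs.closure isClosed_closure
    have hyx : y ⤳ x := by
      rw [specializes_iff_mem_closure, hy.def]
      exact subset_closure (hxs (subset_closure rfl))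
    rw [← h y hyx, hy.def]
    exact subset_closure

lemma Topology.IsOpenEmbedding.map_mem_genericPoints [QuasiSober α] [T0Space α] [QuasiSober β]
    [T0Space β] {f : α → β} (hf : Topology.IsOpenEmbedding f) {x : α} (hx : x ∈ genericPoints α) :
    f x ∈ genericPoints β := by
  rw [mem_genericPoints_iff] at hx ⊢
  intro y hy
  obtain ⟨y, rfl⟩ := hy.mem_open hf.isOpen_range ⟨x, rfl⟩
  rw [hx y (hf.isInducing.specializes_iff.mp hy)]

lemma exists_mem_genericPoints_specializes [QuasiSober α] (x : α) :
    ∃ y ∈ genericPoints α, y ⤳ x := by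
  let C : irreducibleComponents α :=
    ⟨_, irreducibleComponent_mem_irreducibleComponents x⟩
  refine ⟨_, (genericPoints.ofComponent C).2, specializes_iff_mem_closure.mpr ?_⟩
  rw [(genericPoints.isGenericPoint_ofComponent C).def]
  exact mem_irreducibleComponent

end Topology

/-! ### Components of the normal cone and of the total transform. -/

namespace AlgebraicGeometry.Scheme

variable {X Y : Scheme.{u}}

open IdealSheafData

lemma IdealSheafData.specMap_fromSpec_mem_support_iff (K : Y.IdealSheafData) (U : Y.affineOpens)
    {R : CommRingCat.{u}} (ψ : Γ(Y, U.1) ⟶ R) (x : Spec R) :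
    (Spec.map ψ ≫ U.2.fromSpec) x ∈ K.support ↔
      K.ideal U ≤ x.asIdeal.comap ψ.hom := by
  have hmem : U.2.fromSpec (Spec.map ψ x) ∈ U.1 :=
    U.2.range_fromSpec.le ⟨_, rfl⟩
  rw [Hom.comp_apply, mem_support_iff_of_mem hmem]
  exact Set.ext_iff.mp (IsAffineOpen.fromSpec_preimage_zeroLocus U.2 (K.ideal U)) (Spec.map ψ x)

lemma Cover.RelativeGluingData.exists_isOpenImmersion {S : Scheme.{u}} {𝒰 : S.OpenCover}
    [Category 𝒰.I₀] [𝒰.LocallyDirected] (d : 𝒰.RelativeGluingData) [Small.{u} 𝒰.I₀]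
    [Quiver.IsThin 𝒰.I₀] (i : 𝒰.I₀) : ∃ c : d.functor.obj i ⟶ d.glued, IsOpenImmersion c ∧
      c ≫ d.toBase = d.natTrans.app i ≫ 𝒰.f i :=
  ⟨Limits.colimit.ι d.functor i, d.cover.map_prop i, d.ι_toBase i⟩

/-- The normal cone is covered by the spectra of the associated graded rings. -/
lemma IdealSheafData.exists_normalCone_chart (I : Y.IdealSheafData) (U : Y.affineOpens) :
    ∃ c : Spec (.of (AssocGraded (I.ideal U))) ⟶ I.normalCone, IsOpenImmersion c ∧
      c ≫ I.normalConeMap = Spec.map (CommRingCat.ofHom (algebraMap Γ(Y, U.1) _)) ≫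
        U.2.fromSpec := by
  let D := AffineZariskiSite.relativeGluingData I.coequifibered_grDiagramMap
  let i : Y.AffineZariskiSite := ⟨U.1, U.2⟩
  obtain ⟨c, hc, e⟩ := D.exists_isOpenImmersion i
  refine ⟨c, hc, e.trans ?_⟩
  change (Spec.map _ ≫ U.2.isoSpec.inv) ≫ U.1.ι = _
  exact Category.assoc _ _ _

/-- `Q` is the generic point of a component of the normal cone. If `f ∈ Q`, this point maps into the
closed set `K.support`, and so does its closure, a whole distinguished variety. -/
lemma IdealSheafData.algebraMap_notMem_of_mem_minimalPrimes {I K : Y.IdealSheafData}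
    (hKI : ∀ Z ∈ I.distinguishedVarieties, ¬ Z ⊆ K.support) (U : Y.affineOpens) {f : Γ(Y, U.1)}
    (hf : K.ideal U = Ideal.span {f}) {Q : Ideal (AssocGraded (I.ideal U))}
    (hQ : Q ∈ minimalPrimes (AssocGraded (I.ideal U))) : algebraMap _ _ f ∉ Q := by
  intro hfQ
  obtain ⟨c, hc, e⟩ := I.exists_normalCone_chart U
  let x : Spec (.of (AssocGraded (I.ideal U))) := ⟨Q, hQ.1.1⟩
  have hx : x ∈ genericPoints (Spec (.of (AssocGraded (I.ideal U)))) := by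
    rw [mem_genericPoints_iff]
    intro y hy
    have hyx := (PrimeSpectrum.le_iff_specializes y x).mpr hy
    exact PrimeSpectrum.ext (le_antisymm (α := Ideal _) hyx <| hQ.2 ⟨y.2, bot_le⟩ hyx)
  refine hKI _ ⟨_, c.isOpenEmbedding.map_mem_genericPoints hx, rfl⟩ ?_
  refine (image_closure_subset_closure_image I.normalConeMap.continuous).trans
    (K.support.isClosed.closure_subset_iff.mpr ?_)
  rw [Set.image_singleton, Set.singleton_subset_iff, SetLike.mem_coe, ← Hom.comp_apply, e,
    specMap_fromSpec_mem_support_iff, hf, Ideal.span_singleton_le_iff_mem]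
  exact hfQ

variable {Y' : Scheme.{u}} {π : Y' ⟶ Y} {I : Y.IdealSheafData}

lemma IsBlowup.isLocallyNoetherian [IsLocallyNoetherian Y] (hπ : IsBlowup π I) :
    IsLocallyNoetherian Y' := by
  have H (w : Y') : ∃ V : Y'.Opens, w ∈ V ∧ IsLocallyNoetherian V.toScheme := by
    obtain ⟨U, hU, hwU, -⟩ := exists_isAffineOpen_mem_and_subset (U := ⊤) (x := π w) trivial
    obtain ⟨s, hs, V, k, hwV, hk, -⟩ := hπ.exists_chart w ⟨U, hU⟩ hwU
    have : IsNoetherianRing Γ(Y, U) := IsLocallyNoetherian.component_noetherian ⟨U, hU⟩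
    have : IsNoetherianRing (affineBlowup (I.ideal ⟨U, hU⟩) s) := inferInstance
    exact ⟨V, hwV, isLocallyNoetherian_of_isOpenImmersion k⟩
  choose V hwV hV using H
  exact (isLocallyNoetherian_iff_openCover (Y'.openCoverOfIsOpenCover V
    (.mk (eq_top_iff.mpr fun w _ ↦ TopologicalSpace.Opens.mem_iSup.mpr ⟨w, hwV w⟩)))).mpr hV

/-- No component of the total transform of `K` lies in the exceptional divisor. -/
lemma IsBlowup.notMem_support_of_mem_genericPoints [IsLocallyNoetherian Y] {K : Y.IdealSheafData}
    (hπ : IsBlowup π I) (hK : K.IsEffectiveCartier)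
    (hKI : ∀ Z ∈ I.distinguishedVarieties, ¬ Z ⊆ K.support) {w : (K.comap π).subscheme}
    (hw : w ∈ genericPoints (K.comap π).subscheme) :
    (K.comap π).subschemeι w ∉ (I.comap π).support := by
  intro hwI
  set y := (K.comap π).subschemeι w with hy
  have hyK : y ∈ (K.comap π).support := w.2
  obtain ⟨U, hU, f, hf, hfU⟩ := hK (π y)
  obtain ⟨s, hs, V, k, hyV, hk, e⟩ := hπ.exists_chart y U hU
  have : IsNoetherianRing Γ(Y, U.1) := IsLocallyNoetherian.component_noetherian U
  have hmem (L : Y.IdealSheafData) (v : V.toScheme) : V.ι v ∈ (L.comap π).support ↔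
      (L.ideal U).map (algebraMap _ _) ≤ (k v).asIdeal := by
    rw [support_comap]
    change π (V.ι v) ∈ L.support ↔ _
    rw [← Hom.comp_apply, ← e, affineBlowupMap, Hom.comp_apply,
      specMap_fromSpec_mem_support_iff, Ideal.map_le_iff_le_comap]
    rfl
  let v : V.toScheme := ⟨y, hyV⟩
  let P := (k v).asIdeal
  -- A smaller prime is a generization of `k v`, so it stays in the open image of `k`. It then gives
  -- a point of the total transform specializing to `w`, which must be `w` itself.
  have hP : P ∈ (Ideal.span {algebraMap _ (affineBlowup (I.ideal U) s) f}).minimalPrimes := by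
    have h := (hmem K v).mp hyK
    rw [hfU, Ideal.map_span, Set.image_singleton] at h
    refine ⟨⟨(k v).2, h⟩, fun P' hP' hle ↦ ?_⟩
    let x : Spec (.of (affineBlowup (I.ideal U) s)) := ⟨P', hP'.1⟩
    have hx : x ⤳ k v := (PrimeSpectrum.le_iff_specializes x (k v)).mp hle
    obtain ⟨v', hv'⟩ := hx.mem_open k.isOpenEmbedding.isOpen_range ⟨v, rfl⟩
    have hv : v' ⤳ v := by
      rw [← hv'] at hx
      exact k.isOpenEmbedding.isInducing.specializes_iff.mp hx
    have hv'K : V.ι v' ∈ (K.comap π).support := by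
      rw [hmem, hv', hfU, Ideal.map_span, Set.image_singleton]
      exact hP'.2
    obtain ⟨w', hw'⟩ := (K.comap π).range_subschemeι.ge hv'K
    have hw'w : w' ⤳ w := by
      rw [← (K.comap π).subschemeι.isEmbedding.isInducing.specializes_iff, hw', ← hy]
      exact hv.map V.ι.continuous
    have : v' = v := by
      rw [mem_genericPoints_iff.mp hw w' hw'w] at hw'
      exact V.ι.isOpenEmbedding.injective hw'.symm
    rw [this] at hv'
    exact (congr_arg PrimeSpectrum.asIdeal hv').le
  have hsP : algebraMap _ _ s ∈ P := (hmem I v).mp hwI (Ideal.mem_map_of_mem _ hs)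
  obtain ⟨Q, hQ, hfQ⟩ := exists_mem_minimalPrimes_assocGraded hs
    (Ideal.mem_minimalPrimes_span_of_mem_nonZeroDivisors hP
      affineBlowup.algebraMap_mem_nonZeroDivisors hsP)
    (f := f) (hP.1.2 (Ideal.mem_span_singleton_self _))
  exact algebraMap_notMem_of_mem_minimalPrimes hKI U hfU hQ hfQ

end AlgebraicGeometry.Scheme

/-! ### Saturation of ideals, and its compatibility with localization. -/

section Algebra

variable {R S : Type*} [CommRing R] [CommRing S]

/-- The elements `x` of a ring such that `Jⁿ x ⊆ W` for some `n`. -/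
def Ideal.powSaturation (W J : Ideal R) : Ideal R where
  carrier := {x | ∃ n, J ^ n * Ideal.span {x} ≤ W}
  zero_mem' := ⟨0, by simp⟩
  add_mem' := by
    rintro x y ⟨m, hx⟩ ⟨n, hy⟩
    refine ⟨m + n, Ideal.mul_le.mpr fun a ha b hb ↦ ?_⟩
    obtain ⟨c, rfl⟩ := Ideal.mem_span_singleton.mp hb
    rw [add_mul, mul_add]
    refine add_mem (hx ?_) (hy ?_)
    · exact Ideal.mul_mem_mul (Ideal.pow_le_pow_right (Nat.le_add_right m n) ha)
        (Ideal.mem_span_singleton.mpr ⟨c, rfl⟩)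
    · exact Ideal.mul_mem_mul (Ideal.pow_le_pow_right (Nat.le_add_left n m) ha)
        (Ideal.mem_span_singleton.mpr ⟨c, rfl⟩)
  smul_mem' := by
    rintro c x ⟨n, hx⟩
    exact ⟨n, (Ideal.mul_mono_right ((Ideal.span_singleton_le_span_singleton).mpr
      (Dvd.intro_left c rfl))).trans hx⟩

lemma Ideal.le_powSaturation (W J : Ideal R) : W ≤ W.powSaturation J := fun x hx ↦
  ⟨0, by simpa using hx⟩

lemma Ideal.mem_powSaturation_of_mul_mem {W : Ideal R} {t x : R}
    (h : t * x ∈ W.powSaturation (Ideal.span {t})) : x ∈ W.powSaturation (Ideal.span {t}) := by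
  obtain ⟨n, hn⟩ := h
  refine ⟨n + 1, ?_⟩
  rwa [pow_succ, mul_assoc, Ideal.span_singleton_mul_span_singleton]

lemma IsLocalization.exists_mul_mem_of_map_le (M : Submonoid R) [Algebra R S] [IsLocalization M S]
    {I W : Ideal R} (hI : I.FG) (h : I.map (algebraMap R S) ≤ W.map (algebraMap R S)) :
    ∃ m ∈ M, ∀ x ∈ I, m * x ∈ W := by
  obtain ⟨T, rfl⟩ := hI
  have H (t : T) : ∃ m ∈ M, m * t ∈ W :=
    (IsLocalization.algebraMap_mem_map_algebraMap_iff M S W t).mp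
      (h (Ideal.mem_map_of_mem _ (Ideal.subset_span t.2)))
  choose m hm hmt using H
  refine ⟨∏ t, m t, prod_mem fun t _ ↦ hm t, fun x hx ↦ ?_⟩
  induction hx using Submodule.span_induction with
  | mem x hx =>
    obtain ⟨c, hc⟩ := Finset.dvd_prod_of_mem m (Finset.mem_univ ⟨x, hx⟩)
    rw [hc, mul_right_comm]
    exact W.mul_mem_right _ (hmt _)
  | zero => simp
  | add x y _ _ hx hy => rw [mul_add]; exact add_mem hx hy
  | smul c x _ hx => rw [smul_eq_mul, mul_left_comm]; exact W.mul_mem_left _ hx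

/-- Noetherianity makes `J ^ n * (x)` finitely generated, so one denominator serves all its
elements. This is what makes saturation an ideal sheaf. -/
lemma Ideal.map_powSaturation (M : Submonoid R) [Algebra R S] [IsLocalization M S]
    [IsNoetherianRing R] (W J : Ideal R) :
    (W.powSaturation J).map (algebraMap R S) =
      (W.map (algebraMap R S)).powSaturation (J.map (algebraMap R S)) := by
  apply le_antisymm
  · rw [Ideal.map_le_iff_le_comap]
    rintro x ⟨n, hn⟩
    refine ⟨n, ?_⟩
    have := Ideal.map_mono (f := algebraMap R S) hn
    rwa [Ideal.map_mul, Ideal.map_pow, Ideal.map_span, Set.image_singleton] at this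
  · rintro y ⟨n, hn⟩
    obtain ⟨⟨x, m⟩, hxm⟩ := IsLocalization.surj M y
    have hn' : (J ^ n * Ideal.span {x}).map (algebraMap R S) ≤ W.map (algebraMap R S) := by
      rw [Ideal.map_mul, Ideal.map_pow, Ideal.map_span, Set.image_singleton]
      refine (Ideal.mul_mono_right ?_).trans hn
      exact (Ideal.span_singleton_le_span_singleton).mpr ⟨_, hxm.symm⟩
    obtain ⟨r, hr, hrW⟩ := IsLocalization.exists_mul_mem_of_map_le M (IsNoetherian.noetherian _) hn'
    have hrx : r * x ∈ W.powSaturation J := by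
      refine ⟨n, Ideal.mul_le.mpr fun a ha b hb ↦ ?_⟩
      obtain ⟨c, rfl⟩ := Ideal.mem_span_singleton.mp hb
      have := hrW _ (Ideal.mul_mem_mul ha (Ideal.mem_span_singleton.mpr ⟨c, rfl⟩))
      convert this using 1
      ring
    have hmem := Ideal.mem_map_of_mem (algebraMap R S) hrx
    rw [map_mul, ← hxm] at hmem
    rw [← Ideal.unit_mul_mem_iff_mem _ (IsLocalization.map_units S m), mul_comm,
      ← Ideal.unit_mul_mem_iff_mem _ (IsLocalization.map_units S ⟨r, hr⟩)]
    exact hmem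

/-- Length is the Krull dimension of the lattice of ideals, which depends only on the ring. -/
lemma RingEquiv.length_eq (e : R ≃+* S) : Module.length R R = Module.length S S := by
  rw [← WithBot.coe_inj, Module.coe_length, Module.coe_length]
  exact Order.krullDim_eq_of_orderIso e.symm.idealComapOrderIso

end Algebra

/-! ### Saturated ideal sheaves and embedded points. -/

namespace AlgebraicGeometry.Scheme

variable {X Y : Scheme.{u}}

namespace IdealSheafData

lemma isEffectiveCartier_top : (⊤ : Y.IdealSheafData).IsEffectiveCartier := fun y ↦ by
  obtain ⟨U, hU, hyU, -⟩ := exists_isAffineOpen_mem_and_subset (U := ⊤) (x := y) trivial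
  exact ⟨⟨U, hU⟩, hyU, 1, one_mem _, by simp⟩

lemma le_ker_iff_comap_eq_bot {J : Y.IdealSheafData} {f : X ⟶ Y} : J ≤ f.ker ↔ J.comap f = ⊥ := by
  rw [← map_bot, le_map_iff_comap_le, le_bot_iff]

/-- The ideal sheaf of sections `x` with `Jⁿ x ⊆ W` for some `n`. -/
noncomputable def powSaturation [IsLocallyNoetherian Y] (W J : Y.IdealSheafData) :
    Y.IdealSheafData where
  ideal U := (W.ideal U).powSaturation (J.ideal U)
  map_ideal_basicOpen U r := by
    let := (Y.presheaf.map (homOfLE (Y.basicOpen_le r)).op).hom.toAlgebra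
    have : IsLocalization.Away r Γ(Y, Y.basicOpen r) := U.2.isLocalization_basicOpen _
    have : IsNoetherianRing Γ(Y, U.1) := IsLocallyNoetherian.component_noetherian U
    rw [← W.map_ideal_basicOpen, ← J.map_ideal_basicOpen]
    exact Ideal.map_powSaturation (Submonoid.powers r) _ _

lemma le_powSaturation [IsLocallyNoetherian Y] (W J : Y.IdealSheafData) :
    W ≤ W.powSaturation J := fun _ ↦ Ideal.le_powSaturation _ _

lemma ideal_comap_subschemeι (W J : Y.IdealSheafData) (U : Y.affineOpens) {t : Γ(Y, U.1)}
    (h : J.ideal U = Ideal.span {t}) :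
    (J.comap W.subschemeι).ideal ⟨W.subschemeι ⁻¹ᵁ U.1, U.2.preimage _⟩ =
      Ideal.span {W.subschemeι.app U.1 t} := by
  rw [ideal_comap _ _ U _ le_rfl, h, Ideal.map_span, Set.image_singleton, Hom.app_eq_appLE]

lemma isEffectiveCartier_comap_powSaturation [IsLocallyNoetherian Y] (W : Y.IdealSheafData)
    {J : Y.IdealSheafData} (hJ : J.IsEffectiveCartier) :
    (J.comap (W.powSaturation J).subschemeι).IsEffectiveCartier := by
  intro v
  let H := W.powSaturation J
  obtain ⟨U, hU, t, ht, e⟩ := hJ (H.subschemeι v)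
  refine ⟨⟨H.subschemeι ⁻¹ᵁ U.1, U.2.preimage _⟩, hU, _, ?_, H.ideal_comap_subschemeι J U e⟩
  rw [mem_nonZeroDivisors_iff_left]
  intro x hx
  obtain ⟨x, rfl⟩ := H.subschemeι_app_surjective U x
  rw [← map_mul] at hx
  have hker (z : Γ(Y, U.1)) : H.subschemeι.app U.1 z = 0 ↔ z ∈ H.ideal U := by
    rw [← H.ker_subschemeι_app U]; rfl
  rw [hker] at hx ⊢
  change _ ∈ (W.ideal U).powSaturation (J.ideal U) at hx
  change _ ∈ (W.ideal U).powSaturation (J.ideal U)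
  rw [e] at hx ⊢
  exact Ideal.mem_powSaturation_of_mul_mem hx

/-- Locally `J` pulls back to `(t)` and `W` to zero, so a section `z` of the saturation satisfies
`tⁿ z = 0` on `X`, and `t` is a nonzerodivisor there. -/
lemma powSaturation_le_ker [IsLocallyNoetherian Y] {W J : Y.IdealSheafData} {g : X ⟶ Y}
    (hW : W ≤ g.ker) (hJ : (J.comap g).IsEffectiveCartier) : W.powSaturation J ≤ g.ker := by
  rw [le_ker_iff_comap_eq_bot] at hW ⊢
  rw [← le_bot_iff]
  have H (x : X) : ∃ V : X.affineOpens, x ∈ V.1 ∧ ((W.powSaturation J).comap g).ideal V ≤ ⊥ := by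
    obtain ⟨U, hU, hxU, -⟩ := exists_isAffineOpen_mem_and_subset (U := ⊤) (x := g x) trivial
    obtain ⟨V, hxV, hV, t, ht, e⟩ := hJ.exists_le (y := x) (O := g ⁻¹ᵁ U) hxU
    refine ⟨V, hxV, ?_⟩
    rw [ideal_comap _ g ⟨U, hU⟩ V hV, Ideal.map_le_iff_le_comap]
    rintro z ⟨n, hn⟩
    replace hn := Ideal.map_mono (f := (g.appLE U V.1 hV).hom) hn
    rw [Ideal.map_mul, Ideal.map_pow, Ideal.map_span, Set.image_singleton] at hn
    rw [← ideal_comap J g ⟨U, hU⟩ V hV, ← ideal_comap W g ⟨U, hU⟩ V hV, hW, e,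
      Ideal.span_singleton_pow, Ideal.span_singleton_mul_span_singleton,
      Ideal.span_singleton_le_iff_mem] at hn
    exact (mem_nonZeroDivisors_iff_left.mp (pow_mem ht n)) _ hn
  choose V hxV hV using H
  exact le_of_iSup_eq_top V
    (eq_top_iff.mpr fun x _ ↦ TopologicalSpace.Opens.mem_iSup.mpr ⟨x, hxV x⟩) hV

end IdealSheafData

open IdealSheafData

lemma maximalIdeal_stalk_mem_associatedPrimes {V : X.Opens} (hV : IsAffineOpen V)
    (p : PrimeSpectrum Γ(X, V)) (hp : p.asIdeal ∈ associatedPrimes Γ(X, V) Γ(X, V)) :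
    IsLocalRing.maximalIdeal (X.presheaf.stalk (hV.fromSpec p)) ∈
      associatedPrimes (X.presheaf.stalk (hV.fromSpec p)) (X.presheaf.stalk (hV.fromSpec p)) := by
  have hy : hV.fromSpec p ∈ V := hV.range_fromSpec.le ⟨p, rfl⟩
  let := TopCat.Presheaf.algebra_section_stalk X.presheaf ⟨hV.fromSpec p, hy⟩
  have : IsLocalization p.asIdeal.primeCompl (X.presheaf.stalk (hV.fromSpec p)) :=
    hV.isLocalization_stalk' p hy
  open Module.associatedPrimes in
  refine mem_associatedPrimes_of_comap_mem_associatedPrimes_of_isLocalizedModule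
    p.asIdeal.primeCompl (Algebra.linearMap Γ(X, V) (X.presheaf.stalk (hV.fromSpec p))) _ ?_
  have e := IsLocalization.AtPrime.under_maximalIdeal (X.presheaf.stalk (hV.fromSpec p)) p.asIdeal
  rw [← e] at hp
  exact hp

/-- A locally principal ideal sheaf is effective Cartier on a closed subscheme without embedded
points none of whose generic points lies in its support. -/
lemma HasNoEmbeddedPoints.isEffectiveCartier_comap [IsLocallyNoetherian Y] {W J : Y.IdealSheafData}
    (hW : HasNoEmbeddedPoints W.subscheme) (hJ : J.IsEffectiveCartier)
    (h : ∀ w ∈ genericPoints W.subscheme, W.subschemeι w ∉ J.support) :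
    (J.comap W.subschemeι).IsEffectiveCartier := by
  intro w
  obtain ⟨U, hU, t, ht, e⟩ := hJ (W.subschemeι w)
  let V : W.subscheme.affineOpens := ⟨W.subschemeι ⁻¹ᵁ U.1, U.2.preimage _⟩
  have eV := W.ideal_comap_subschemeι J U e
  refine ⟨V, hU, _, ?_, eV⟩
  have : IsLocallyNoetherian W.subscheme := LocallyOfFiniteType.isLocallyNoetherian W.subschemeι
  have : IsNoetherianRing Γ(W.subscheme, V.1) := IsLocallyNoetherian.component_noetherian V
  by_contra hnz
  -- In a Noetherian ring a zero divisor lies in some associated prime. Here that prime is a generic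
  -- point of `W`, which would then lie in the support of `J`.
  have hmem : W.subschemeι.app U.1 t ∈ ⋃ p ∈ associatedPrimes Γ(W.subscheme, V.1)
      Γ(W.subscheme, V.1), (p : Set Γ(W.subscheme, V.1)) := by
    rw [biUnion_associatedPrimes_eq_compl_nonZeroDivisors]
    exact hnz
  simp only [Set.mem_iUnion] at hmem
  obtain ⟨p, hp, htp⟩ := hmem
  let x : PrimeSpectrum Γ(W.subscheme, V.1) := ⟨p, hp.1⟩
  refine h _ (hW _ (maximalIdeal_stalk_mem_associatedPrimes V.2 x hp)) ?_
  have hxV : V.2.fromSpec x ∈ V.1 := V.2.range_fromSpec.le ⟨x, rfl⟩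
  change V.2.fromSpec x ∈ J.support.preimage W.subschemeι.continuous
  rw [← support_comap, mem_support_iff_of_mem hxV]
  refine (Set.ext_iff.mp (IsAffineOpen.fromSpec_preimage_zeroLocus V.2 _) x).mpr ?_
  rw [eV]
  exact (Ideal.span_singleton_le_iff_mem _).mpr htp

/-! ### The proper transform inside the total transform. -/

section ProperTransform

variable {Y' K' : Scheme.{u}} {I K : Y.IdealSheafData} {π : Y' ⟶ Y} {ρ : K' ⟶ K.subscheme}
  (hπ : IsBlowup π I) (hρ : IsBlowup ρ (I.comap K.subschemeι))

lemma isEffectiveCartier_comap_properTransformMap :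
    ((I.comap π).comap (properTransformMap hπ hρ)).IsEffectiveCartier := by
  rw [← comap_comp, properTransformMap_comp, comap_comp]
  exact hρ.isEffectiveCartier

lemma comap_le_ker_properTransformMap : K.comap π ≤ (properTransformMap hπ hρ).ker := by
  rw [← le_map_iff_comap_le, map_ker, properTransformMap_comp]
  exact K.ker_subschemeι.ge.trans (Hom.le_ker_comp _ _)

/-- The map `g ≫ π` factors through `K`, hence lifts to `K'` by the universal property of `ρ`;
uniqueness in that of `π` identifies the composite with `g`. -/
lemma exists_comp_properTransformMap_eq {T : Scheme.{u}} (g : T ⟶ Y') (hg : K.comap π ≤ g.ker)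
    (hI : ((I.comap π).comap g).IsEffectiveCartier) :
    ∃ m : T ⟶ K', m ≫ properTransformMap hπ hρ = g := by
  rw [← comap_comp] at hI
  have hK : K.subschemeι.ker ≤ (g ≫ π).ker := by
    rwa [ker_subschemeι, ← map_ker, le_map_iff_comap_le]
  obtain ⟨m, hm, -⟩ := hρ.existsUnique (IsClosedImmersion.lift K.subschemeι (g ≫ π) hK) (by
    rwa [← comap_comp, IsClosedImmersion.lift_fac])
  refine ⟨m, (hπ.existsUnique (g ≫ π) hI).unique ?_ rfl⟩
  rw [Category.assoc, properTransformMap_comp, reassoc_of% hm, IsClosedImmersion.lift_fac]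

lemma isClosedImmersion_properTransformMap [IsLocallyNoetherian Y'] :
    IsClosedImmersion (properTransformMap hπ hρ) := by
  let j := properTransformMap hπ hρ
  let H := (K.comap π).powSaturation (I.comap π)
  obtain ⟨m, hm⟩ := exists_comp_properTransformMap_eq hπ hρ H.subschemeι
    (H.ker_subschemeι.symm ▸ le_powSaturation _ _)
    (isEffectiveCartier_comap_powSaturation _ hπ.isEffectiveCartier)
  have hH : H.subschemeι.ker ≤ j.ker := H.ker_subschemeι.symm ▸ powSaturation_le_ker
    (comap_le_ker_properTransformMap hπ hρ) (isEffectiveCartier_comap_properTransformMap hπ hρ)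
  let e : K' ⟶ H.subscheme := IsClosedImmersion.lift H.subschemeι j hH
  have he : e ≫ H.subschemeι = j := IsClosedImmersion.lift_fac _ _ _
  have : IsIso e := by
    refine ⟨m, ?_, ?_⟩
    · refine (hρ.existsUnique ρ hρ.isEffectiveCartier).unique ?_ (Category.id_comp _)
      rw [← cancel_mono K.subschemeι, ← properTransformMap_comp hπ hρ]
      simp only [Category.assoc, ← properTransformMap_comp hπ hρ]
      rw [reassoc_of% hm, reassoc_of% he]
    · rw [← cancel_mono H.subschemeι, Category.assoc, he, hm, Category.id_comp]
  change IsClosedImmersion j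
  rw [← he]
  infer_instance

/-- A surjective closed immersion is a homeomorphism, so generic points correspond, and the stalk
isomorphisms match their multiplicities. -/
lemma fundamentalCycle_comp_subschemeι {W : Y.IdealSheafData} (c : X ⟶ W.subscheme)
    [IsClosedImmersion c] [Surjective c]
    (hc : ∀ x ∈ genericPoints X, IsIso (c.stalkMap x)) :
    fundamentalCycle (c ≫ W.subschemeι) = fundamentalCycle W.subschemeι := by
  have hgen (x : X) : c x ∈ genericPoints W.subscheme ↔ x ∈ genericPoints X := by
    simp_rw [mem_genericPoints_iff, c.surjective.forall, c.isEmbedding.isInducing.specializes_iff,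
      c.isEmbedding.injective.eq_iff]
  ext v
  refine finsum_mem_eq_of_bijOn c ⟨?_, c.isEmbedding.injective.injOn, ?_⟩ ?_
  · rintro x ⟨hx, hx'⟩
    exact ⟨hx, (hgen x).mpr hx'⟩
  · rintro w ⟨hw, hw'⟩
    obtain ⟨x, rfl⟩ := c.surjective w
    exact ⟨x, ⟨hw, (hgen x).mp hw'⟩, rfl⟩
  · rintro x ⟨-, hx⟩
    have := hc x hx
    exact (asIso (c.stalkMap x)).commRingCatIsoToRingEquiv.length_eq.symm

end ProperTransform

end AlgebraicGeometry.Scheme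

theorem mainTheorem5 (Y : Scheme.{u}) [IsLocallyNoetherian Y] (I K : Y.IdealSheafData)
    (hK : K.IsEffectiveCartier) (hKI : ∀ Z ∈ I.distinguishedVarieties, ¬ Z ⊆ K.support)
    (Y' : Scheme.{u}) (π : Y' ⟶ Y) (hπ : Scheme.IsBlowup π I)
    (K' : Scheme.{u}) (ρ : K' ⟶ K.subscheme)
    (hρ : Scheme.IsBlowup ρ (I.comap K.subschemeι)) :
    IsClosedImmersion (Scheme.properTransformMap hπ hρ) ∧
    Set.range (Scheme.properTransformMap hπ hρ) = π ⁻¹' K.support ∧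
    Scheme.fundamentalCycle (Scheme.properTransformMap hπ hρ) =
      Scheme.fundamentalCycle (K.comap π).subschemeι ∧
    (Scheme.HasNoEmbeddedPoints (K.comap π).subscheme →
      (Scheme.properTransformMap hπ hρ).ker = K.comap π) := by
  have := hπ.isLocallyNoetherian
  let W := K.comap π
  let J := I.comap π
  set j := Scheme.properTransformMap hπ hρ
  have hjc : IsClosedImmersion j := Scheme.isClosedImmersion_properTransformMap hπ hρ
  have hWj : W ≤ j.ker := Scheme.comap_le_ker_properTransformMap hπ hρ
  let c : K' ⟶ W.subscheme := IsClosedImmersion.lift W.subschemeι j (W.ker_subschemeι.symm ▸ hWj)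
  have hc : c ≫ W.subschemeι = j := IsClosedImmersion.lift_fac _ _ _
  have hcc : IsClosedImmersion c := by
    have : IsClosedImmersion (c ≫ W.subschemeι) := hc ▸ hjc
    exact IsClosedImmersion.of_comp_isClosedImmersion c W.subschemeι
  have hgen (w : W.subscheme) (hw : w ∈ genericPoints W.subscheme) : W.subschemeι w ∉ J.support :=
    hπ.notMem_support_of_mem_genericPoints hK hKI hw
  let O : W.subscheme.Opens := (J.support.preimage W.subschemeι.continuous).compl
  -- Off the exceptional divisor its ideal becomes the unit ideal, which is Cartier with equation
  -- `1`, so `O` lifts to `K'`.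
  obtain ⟨m, hm⟩ := Scheme.exists_comp_properTransformMap_eq hπ hρ (O.ι ≫ W.subschemeι)
    (W.ker_subschemeι.symm.le.trans (Scheme.Hom.le_ker_comp _ _)) (by
      convert Scheme.IdealSheafData.isEffectiveCartier_top
      rw [← Scheme.IdealSheafData.support_eq_bot_iff, Scheme.IdealSheafData.support_comap]
      ext x
      exact iff_of_false x.2 id)
  have hmc : m ≫ c = O.ι := by
    rw [← cancel_mono W.subschemeι, Category.assoc, hc]
    exact hm
  -- The image of `c` is closed and contains every generic point of `W`, since these lie in `O`.
  have hsurj : Function.Surjective c := by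
    intro w
    obtain ⟨y, hy, hyw⟩ := exists_mem_genericPoints_specializes w
    have hyc : y ∈ Set.range c := ⟨m ⟨y, hgen y hy⟩, congr($hmc ⟨y, hgen y hy⟩)⟩
    exact hyw.mem_closed c.isClosedEmbedding.isClosed_range hyc
  have : Surjective c := ⟨hsurj⟩
  have hiso : IsIso (c ∣_ O) := by
    let l : O.toScheme ⟶ (c ⁻¹ᵁ O).toScheme := IsOpenImmersion.lift (c ⁻¹ᵁ O).ι m (by
      rintro _ ⟨x, rfl⟩
      rw [Scheme.Opens.range_ι]
      change (m ≫ c) x ∈ O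
      rw [hmc]
      exact x.2)
    have hl : l ≫ (c ⁻¹ᵁ O).ι = m := IsOpenImmersion.lift_fac _ _ _
    have h1 : l ≫ (c ∣_ O) = 𝟙 _ := by
      rw [← cancel_mono O.ι, Category.assoc, morphismRestrict_ι, reassoc_of% hl, hmc,
        Category.id_comp]
    refine ⟨l, ?_, h1⟩
    rw [← cancel_mono (c ∣_ O), Category.assoc, h1, Category.comp_id, Category.id_comp]
  refine ⟨hjc, ?_, ?_, fun hne ↦ ?_⟩
  · rw [← hc, Scheme.Hom.comp_base, TopCat.coe_comp, Set.range_comp, hsurj.range_eq, Set.image_univ,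
      Scheme.IdealSheafData.range_subschemeι, Scheme.IdealSheafData.support_comap]
    rfl
  · rw [← hc]
    refine Scheme.fundamentalCycle_comp_subschemeι c fun x hx ↦ ?_
    have hxO : c x ∈ O := hgen _ (by
      rw [mem_genericPoints_iff] at hx ⊢
      intro y hy
      obtain ⟨y, rfl⟩ := hsurj y
      rw [hx y (c.isEmbedding.isInducing.specializes_iff.mp hy)])
    have (y : (c ⁻¹ᵁ O).toScheme) : IsIso ((c ∣_ O).stalkMap y) := inferInstance
    exact ((MorphismProperty.isomorphisms _).arrow_mk_iso_iff
      (morphismRestrictStalkMap c O ⟨x, hxO⟩)).mp (this _)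
  · obtain ⟨m, hm⟩ := Scheme.exists_comp_properTransformMap_eq hπ hρ W.subschemeι
      W.ker_subschemeι.ge (hne.isEffectiveCartier_comap hπ.isEffectiveCartier hgen)
    have hle := Scheme.Hom.le_ker_comp m j
    rw [show m ≫ j = _ from hm, W.ker_subschemeι] at hle
    exact hle.antisymm hWj
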